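/- Let $d\ge 1$, let $\Omega\subset\mathbb{R}^d$ be a compact convex polyhedron (a compact intersection of finitely many closed half-spaces), and let $\mu$ be a probability measure on $\Omega$ with density $\rho:\Omega\to[0,\infty)$ with respect to the Lebesgue measure. Let $x[1],\dots,x[n]\in\Omega$ be pairwise distinct points and let $w\in\mathbb{R}^n$ satisfy $w[i]\ge 0$ and $\sum_{i=1}^n w[i]=1$. For $\psi\in\mathbb{R}^n$ define the Laguerre cells $$\mathcal{L}_i(\psi,x)=\{y\in\Omega:\ \|y-x[i]\|^2-\psi[i]\le\|y-x[j]\|^2-\psi[j]\ \text{ for all } j\ne i\}$$ and the dual function $$g(\psi)=\sum_{i=1}^n\int_{\mathcal{L}_i(\psi,x)}\bigl(\|x[i]-y\|^2-\psi[i]\bigr)\,d\mu(y)+\sum_{i=1}^n\psi[i]\,w[i].$$ Then $g$ is concave on $\mathbb{R}^n$ and differentiable at every $\psi\in\mathbb{R}^n$, with $$\frac{\partial g}{\partial\psi_i}(\psi)=w[i]-\mu(\mathcal{L}_i(\psi,x)),\qquad 1\le i\le n.$$ If $\rho$ is essentially bounded on $\Omega$, then $\nabla g$ is Lipschitz continuous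 on $\mathbb{R}^n$. If $\rho\in C^1(\Omega)$, then $g$ is twice differentiable at almost every $\psi\in\mathbb{R}^n$. Moreover, at every $\psi$ at which $g$ is twice differentiable, $$\frac{\partial^2 g}{\partial\psi_i\partial\psi_j}(\psi)=\int_{\partial\mathcal{L}_i(\psi,x)\cap\partial\mathcal{L}_j(\psi,x)}\frac{\rho(y)}{2\,\|x[i]-x[j]\|}\,d\mathcal{H}^{d-1}(y)\qquad\text{for } i\ne j,$$ where $\partial$ denotes the topological boundary in $\mathbb{R}^d$ and $\mathcal{H}^{d-1}$ is the $(d-1)$-dimensional Hausdorff measure, normalized to agree with surface measure on hyperplanes (arc length if $d=2$), and $$\sum_{j=1}^n\frac{\partial^2 g}{\partial\psi_i\partial\psi_j}(\psi)=0\qquad\text{for every } 1\le i\le n.$$ -/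

import Mathlib

open MeasureTheory Set
open scoped Topology NNReal ENNReal

noncomputable section

namespace SemiDiscrete

/-- A compact convex polyhedron in `ℝ^d`: a compact set which is the intersection of finitely many
closed half-spaces. -/
def IsCompactConvexPolyhedron {d : ℕ} (Ω : Set (EuclideanSpace ℝ (Fin d))) : Prop :=
  IsCompact Ω ∧ ∃ H : Finset (EuclideanSpace ℝ (Fin d) × ℝ),
    Ω = {y | ∀ h ∈ H, inner ℝ h.1 y ≤ h.2}

/-- The Laguerre cell of the site `x i` in `Ω`, for the weight vector `ψ`. -/
def laguerreCell {d n : ℕ} (Ω : Set (EuclideanSpace ℝ (Fin d)))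
    (x : Fin n → EuclideanSpace ℝ (Fin d)) (ψ : EuclideanSpace ℝ (Fin n)) (i : Fin n) :
    Set (EuclideanSpace ℝ (Fin d)) :=
  {y | y ∈ Ω ∧ ∀ j : Fin n, j ≠ i → ‖y - x i‖ ^ 2 - ψ i ≤ ‖y - x j‖ ^ 2 - ψ j}

/-- The semi-discrete dual function `ψ ↦ g(ψ, x, w)` of quadratic optimal transport. -/
def dualFunction {d n : ℕ} (Ω : Set (EuclideanSpace ℝ (Fin d)))
    (μ : Measure (EuclideanSpace ℝ (Fin d))) (x : Fin n → EuclideanSpace ℝ (Fin d))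
    (w : Fin n → ℝ) (ψ : EuclideanSpace ℝ (Fin n)) : ℝ :=
  (∑ i, ∫ y in laguerreCell Ω x ψ i, (‖x i - y‖ ^ 2 - ψ i) ∂μ) + ∑ i, ψ i * w i

/-- `f` is twice (Fréchet) differentiable at `p`: it is differentiable near `p`, and its
derivative is differentiable at `p`. -/
def TwiceDifferentiableAt {n : ℕ} (f : EuclideanSpace ℝ (Fin n) → ℝ)
    (p : EuclideanSpace ℝ (Fin n)) : Prop :=
  (∀ᶠ q in 𝓝 p, DifferentiableAt ℝ f q) ∧ DifferentiableAt ℝ (fderiv ℝ f) p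

/-- The partial derivative `∂f/∂ψ_i` at `p`. -/
def partialDeriv {n : ℕ} (i : Fin n) (f : EuclideanSpace ℝ (Fin n) → ℝ)
    (p : EuclideanSpace ℝ (Fin n)) : ℝ :=
  lineDeriv ℝ f p (EuclideanSpace.single i 1)

end SemiDiscrete

end

/-! Up to null overlaps the cells partition `Ω`, and on the cell of `x i` the shifted cost of `x i`
is the smallest. Hence g is a linear function plus the integral of `minCost`, a minimum of finitely
many affine functions of ψ (`dualFunction_eq`). Concavity is immediate. For almost every y the
minimum has a single minimiser, so `minCost` is differentiable in ψ; it is also 1-Lipschitz in ψ, so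
one may differentiate under the integral, and the gradient is read off from the masses of the cells.

When ψ changes to φ, the part of a cell that disappears lies in slabs of width O(‖φ - ψ‖) around the
separating hyperplanes. A bounded density therefore gives a Lipschitz gradient, and Rademacher's
theorem gives twice differentiability almost everywhere.

For the mixed derivatives, raising ψ i cuts a slab parallel to the separating hyperplane off the
cell of `x j`. By Cavalieri its mass is an integral of slice integrals, and these are
right-continuous at the hyperplane if the convex cell reaches strictly beyond it. So the right
derivative is minus the integral over the common face; at a point of twice differentiability this
one-sided value determines the entry.

If the cell of `x j` lies inside the hyperplane, symmetry of the Hessian lets the cell of `x i` be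
used instead. If both cells lie in it, both are null and the entry is 0; the face integral also
vanishes, because the face is covered by faces shared with cells of positive volume, on which the
case already proved forces ρ = 0 almost everywhere (`hessian_eq_setIntegral`). -/

namespace SemiDiscrete

/-! ### Slicing by parallel hyperplanes -/

section Slicing

variable {V : Type*} [NormedAddCommGroup V] [InnerProductSpace ℝ V]

/-- The point at height `p.1` in the direction `u` above the point `p.2` of the hyperplane `uᗮ`. -/
def slicePoint (u : V) (p : ℝ × (ℝ ∙ u)ᗮ) : V := p.1 • u + (p.2 : V)

theorem continuous_slicePoint (u : V) : Continuous (slicePoint u) := by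
  unfold slicePoint
  fun_prop

theorem inner_slicePoint {u : V} (hu : ‖u‖ = 1) (p : ℝ × (ℝ ∙ u)ᗮ) :
    inner ℝ u (slicePoint u p) = p.1 := by
  have h : inner ℝ u (p.2 : V) = 0 := Submodule.mem_orthogonal_singleton_iff_inner_right.1 p.2.2
  simp [slicePoint, inner_add_right, inner_smul_right, h, hu]

theorem norm_le_norm_slicePoint {u : V} (p : ℝ × (ℝ ∙ u)ᗮ) :
    ‖p.2‖ ≤ ‖slicePoint u p‖ := by
  have h : inner ℝ u (p.2 : V) = 0 := Submodule.mem_orthogonal_singleton_iff_inner_right.1 p.2.2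
  have h2 : ‖slicePoint u p‖ * ‖slicePoint u p‖ =
      ‖p.1 • u‖ * ‖p.1 • u‖ + ‖(p.2 : V)‖ * ‖(p.2 : V)‖ :=
    norm_add_sq_eq_norm_sq_add_norm_sq_of_inner_eq_zero _ _ (by rw [inner_smul_left, h, mul_zero])
  have h3 : ‖p.2‖ = ‖(p.2 : V)‖ := rfl
  nlinarith [norm_nonneg (slicePoint u p), norm_nonneg (p.1 • u), norm_nonneg (p.2 : V)]

theorem exists_slicePoint_eq {u : V} (hu : ‖u‖ = 1) (y : V) :
    ∃ z : (ℝ ∙ u)ᗮ, slicePoint u (inner ℝ u y, z) = y := by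
  refine ⟨⟨y - inner ℝ u y • u, ?_⟩, ?_⟩
  · rw [Submodule.mem_orthogonal_singleton_iff_inner_right, inner_sub_right, inner_smul_right,
      real_inner_self_eq_norm_sq, hu]
    simp
  · simp [slicePoint]

theorem isometry_slicePoint (u : V) (a : ℝ) : Isometry fun z => slicePoint u (a, z) := by
  refine Isometry.of_dist_eq fun z z' => ?_
  simp only [slicePoint]
  rw [dist_add_left]
  rfl

variable [FiniteDimensional ℝ V] [MeasurableSpace V] [BorelSpace V]

/-- For a unit vector, s ↦ s • u is an isometry of ℝ onto its span, and the orthogonal decomposition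
of `V` is an isometry for the ℓ² product, whose volume is the product volume. -/
theorem measurePreserving_slicePoint {u : V} (hu : ‖u‖ = 1) :
    MeasurePreserving (slicePoint u) := by
  have h1 := (LinearIsometryEquiv.toSpanUnitSingleton (𝕜 := ℝ) u hu).measurePreserving.prod
    (MeasurePreserving.id (volume : Measure (ℝ ∙ u)ᗮ))
  have h2 := (WithLp.volume_preserving_toLp (ℝ ∙ u) (ℝ ∙ u)ᗮ).comp h1
  have h3 := ((ℝ ∙ u).orthogonalDecomposition.symm.measurePreserving).comp h2
  convert! h3 using 1

theorem measurableEmbedding_slicePoint {u : V} (hu : ‖u‖ = 1) :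
    MeasurableEmbedding (slicePoint u) := by
  refine (continuous_slicePoint u).measurableEmbedding fun p q h => ?_
  have h1 : p.1 = q.1 := by rw [← inner_slicePoint hu p, h, inner_slicePoint hu]
  refine Prod.ext h1 ?_
  simpa [slicePoint, h1] using h

/-- Cavalieri's principle, for slices orthogonal to a unit vector. -/
theorem integral_eq_integral_integral_slicePoint {u : V} (hu : ‖u‖ = 1) {f : V → ℝ}
    (hf : Integrable f) :
    ∫ y, f y = ∫ s : ℝ, ∫ z : (ℝ ∙ u)ᗮ, f (slicePoint u (s, z)) := by
  rw [← (measurePreserving_slicePoint hu).integral_comp (measurableEmbedding_slicePoint hu)]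
  exact integral_prod (fun p => f (slicePoint u p))
    ((measurePreserving_slicePoint hu).integrable_comp_of_integrable hf)

theorem integrable_integral_slicePoint {u : V} (hu : ‖u‖ = 1) {f : V → ℝ} (hf : Integrable f) :
    Integrable fun s : ℝ => ∫ z : (ℝ ∙ u)ᗮ, f (slicePoint u (s, z)) :=
  ((measurePreserving_slicePoint hu).integrable_comp_of_integrable hf).integral_prod_left

/-- The volume of the part of a ball between two parallel hyperplanes is at most proportional to
the distance of the hyperplanes. -/
theorem volume_slab_le {u : V} (hu : ‖u‖ = 1) (R a b : ℝ) :
    volume {y : V | ‖y‖ ≤ R ∧ a ≤ inner ℝ u y ∧ inner ℝ u y ≤ b} ≤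
      ENNReal.ofReal (b - a) * volume (Metric.closedBall (0 : (ℝ ∙ u)ᗮ) R) := by
  have hmeas : MeasurableSet {y : V | ‖y‖ ≤ R ∧ a ≤ inner ℝ u y ∧ inner ℝ u y ≤ b} := by
    refine IsClosed.measurableSet ?_
    have hc : Continuous fun y : V => inner ℝ u y := by fun_prop
    exact (isClosed_le continuous_norm continuous_const).inter
      ((isClosed_le continuous_const hc).inter (isClosed_le hc continuous_const))
  rw [← (measurePreserving_slicePoint hu).measure_preimage hmeas.nullMeasurableSet,
    ← Real.volume_Icc, ← Measure.prod_prod]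
  refine measure_mono fun p hp => ?_
  simp only [mem_preimage, mem_ofPred_eq, inner_slicePoint hu] at hp
  exact ⟨hp.2, by simpa using (norm_le_norm_slicePoint p).trans hp.1⟩

/-- A hyperplane is a null set. -/
theorem volume_hyperplane {u : V} (hu : u ≠ 0) (a : ℝ) :
    volume {y : V | inner ℝ u y = a} = 0 := by
  have h : ∀ y ∈ {y : V | inner ℝ u y = a}, (a / ‖u‖ ^ 2) • u - y ∈ (ℝ ∙ u)ᗮ := by
    intro y hy
    have : ‖u‖ ≠ 0 := norm_ne_zero_iff.2 hu
    rw [Submodule.mem_orthogonal_singleton_iff_inner_right, inner_sub_right, inner_smul_right,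
      real_inner_self_eq_norm_sq, show inner ℝ u y = a from hy]
    field_simp
    ring
  refine measure_mono_null (t := (AffineSubspace.mk' ((a / ‖u‖ ^ 2) • u) (ℝ ∙ u)ᗮ : Set V))
    (fun y hy => ?_) (Measure.addHaar_affineSubspace _ _ fun htop => ?_)
  · rw [SetLike.mem_coe, AffineSubspace.mem_mk', vsub_eq_sub]
    simpa using neg_mem (h y hy)
  · have h1 := congrArg AffineSubspace.direction htop
    rw [AffineSubspace.direction_mk', AffineSubspace.direction_top,
      Submodule.orthogonal_eq_top_iff] at h1
    exact hu (Submodule.span_singleton_eq_bot.1 h1)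

/-- The Euclidean Hausdorff measure of codimension one, restricted to a hyperplane, is the volume
of the parallel hyperplane through the origin. -/
theorem euclideanHausdorffMeasure_restrict_hyperplane {u : V} (hu : ‖u‖ = 1) (a : ℝ) :
    (Measure.euclideanHausdorffMeasure (Module.finrank ℝ V - 1)).restrict
        {y : V | inner ℝ u y = a} =
      Measure.map (fun z : (ℝ ∙ u)ᗮ => slicePoint u (a, z)) volume := by
  have hrank : Module.finrank ℝ V - 1 = Module.finrank ℝ (ℝ ∙ u)ᗮ := by
    have h := (ℝ ∙ u).finrank_add_finrank_orthogonal
    rw [finrank_span_singleton (norm_ne_zero_iff.1 (by rw [hu]; exact one_ne_zero))] at h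
    omega
  have hrange : range (fun z => slicePoint u (a, z)) = {y | inner ℝ u y = a} := by
    ext y
    constructor
    · rintro ⟨z, rfl⟩
      exact inner_slicePoint hu _
    · intro hy
      obtain ⟨z, hz⟩ := exists_slicePoint_eq hu y
      exact ⟨z, by rw [← hz, show inner ℝ u y = a from hy]⟩
  rw [hrank, ← hrange, ← (isometry_slicePoint u a).map_euclideanHausdorffMeasure,
    InnerProductSpace.euclideanHausdorffMeasure_eq_volume]

theorem euclideanHausdorffMeasure_slice_lt_top {u : V} (hu : ‖u‖ = 1) {K : Set V}
    (hK : IsCompact K) (a : ℝ) :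
    Measure.euclideanHausdorffMeasure (Module.finrank ℝ V - 1)
      (K ∩ {y | inner ℝ u y = a}) < ∞ := by
  obtain ⟨R, hR⟩ := hK.isBounded.exists_norm_le
  rw [← Measure.restrict_apply hK.measurableSet, euclideanHausdorffMeasure_restrict_hyperplane hu,
    Measure.map_apply (isometry_slicePoint u a).continuous.measurable hK.measurableSet]
  refine (measure_mono fun z hz => ?_).trans_lt
    (measure_closedBall_lt_top (x := (0 : (ℝ ∙ u)ᗮ)) (r := R))
  simpa using (norm_le_norm_slicePoint (a, z)).trans (hR _ hz)

/-- An integral over a slice with respect to the Euclidean Hausdorff measure, as an integral over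
the parallel hyperplane through the origin. -/
theorem setIntegral_slice {u : V} (hu : ‖u‖ = 1) {K : Set V} (hK : MeasurableSet K) (ρ : V → ℝ)
    (a : ℝ) :
    ∫ y in K ∩ {y | inner ℝ u y = a}, ρ y
        ∂(Measure.euclideanHausdorffMeasure (Module.finrank ℝ V - 1)) =
      ∫ z : (ℝ ∙ u)ᗮ, K.indicator ρ (slicePoint u (a, z)) := by
  rw [← Measure.restrict_restrict hK, euclideanHausdorffMeasure_restrict_hyperplane hu,
    ← integral_indicator hK,
    (isometry_slicePoint u a).isClosedEmbedding.measurableEmbedding.integral_map]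

end Slicing

/-! ### Continuity of slice integrals and the derivative of a truncated integral -/

section Slicing

variable {V : Type*} [NormedAddCommGroup V] [InnerProductSpace ℝ V]
/-- If a segment joins a point of the slice of the convex set `K` at height `a` with a point of `K`
above that slice, then an interior point of the slice stays in `K` when it moves up. -/
theorem eventually_slicePoint_mem {u : V} {K : Set V} (hKc : Convex ℝ K) {a s₀ : ℝ}
    (hs₀ : a < s₀) {p : (ℝ ∙ u)ᗮ} (hp : slicePoint u (s₀, p) ∈ K) {z : (ℝ ∙ u)ᗮ}
    (hz : z ∈ interior {z | slicePoint u (a, z) ∈ K}) :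
    ∀ᶠ s in 𝓝[≥] a, slicePoint u (s, z) ∈ K := by
  have hne₀ : s₀ - a ≠ 0 := (sub_pos.2 hs₀).ne'
  -- `c s` is chosen so that the point above z at height s lies on the segment from the point above
  -- `c s` at height a to the point above p at height s₀, at parameter `l s`. As s → a, `c s` → z,
  -- so `c s` stays in the slice.
  let l : ℝ → ℝ := fun s => (s - a) / (s₀ - a)
  let c : ℝ → (ℝ ∙ u)ᗮ := fun s => (1 - l s)⁻¹ • (z - l s • p)
  have hl : ContinuousAt l a := by
    simp only [l]
    fun_prop
  have hla : l a = 0 := by simp [l]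
  have hc : ContinuousAt c a := by
    have : (1 - l a) ≠ 0 := by simp [hla]
    exact ((continuousAt_const.sub hl).inv₀ this).smul
      (continuousAt_const.sub (hl.smul continuousAt_const))
  have hca : c a = z := by simp [c, hla]
  have h1 : ∀ᶠ s in 𝓝 a, c s ∈ interior {z | slicePoint u (a, z) ∈ K} :=
    hc.eventually (by rw [hca]; exact isOpen_interior.mem_nhds hz)
  have h2 : ∀ᶠ s in 𝓝 a, l s < 1 := hl.eventually (by rw [hla]; exact gt_mem_nhds one_pos)
  filter_upwards [mem_nhdsWithin_of_mem_nhds h1, mem_nhdsWithin_of_mem_nhds h2,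
    self_mem_nhdsWithin] with s hs hs1 hsa
  have hl0 : 0 ≤ l s := div_nonneg (sub_nonneg.2 hsa) (sub_pos.2 hs₀).le
  have hne : 1 - l s ≠ 0 := (sub_pos.2 hs1).ne'
  have hcK : slicePoint u (a, c s) ∈ K := interior_subset (s := {z | slicePoint u (a, z) ∈ K}) hs
  have hmem := hKc hcK hp (sub_pos.2 hs1).le hl0 (by ring)
  have hz' : (z : V) = (1 - l s) • (c s : V) + l s • (p : V) := by
    simp [c, smul_smul, mul_inv_cancel₀ hne]
  have hs' : s = (1 - l s) * a + l s * s₀ := by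
    have : l s * (s₀ - a) = s - a := div_mul_cancel₀ _ hne₀
    linarith
  convert hmem using 1
  simp only [slicePoint]
  conv_lhs => rw [hs', hz']
  module

variable [FiniteDimensional ℝ V] [MeasurableSpace V] [BorelSpace V]

theorem integrable_indicator_of_continuousOn {K : Set V} (hK : IsCompact K) {ρ : V → ℝ}
    (hρ : ContinuousOn ρ K) : Integrable (K.indicator ρ) :=
  (hρ.integrableOn_compact hK).integrable_indicator hK.measurableSet

/-- The integral of a continuous function over the slices of a compact convex set `K` is
right-continuous at every height above which `K` still has points. -/
theorem continuousWithinAt_integral_slicePoint {u : V} (hu : ‖u‖ = 1) {K : Set V}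
    (hK : IsCompact K) (hKc : Convex ℝ K) {ρ : V → ℝ} (hρ : ContinuousOn ρ K) {a : ℝ}
    (hne : ∃ y ∈ K, a < inner ℝ u y) :
    ContinuousWithinAt (fun s : ℝ => ∫ z : (ℝ ∙ u)ᗮ, K.indicator ρ (slicePoint u (s, z)))
      (Ici a) a := by
  obtain ⟨y₀, hy₀, hay₀⟩ := hne
  obtain ⟨p, hp⟩ := exists_slicePoint_eq hu y₀
  rw [← hp] at hy₀
  obtain ⟨R, hR⟩ := hK.isBounded.exists_norm_le
  obtain ⟨M, hM⟩ := hK.exists_bound_of_continuousOn hρ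
  have hM0 : 0 ≤ M := (norm_nonneg _).trans (hM _ hy₀)
  refine tendsto_integral_filter_of_dominated_convergence
    ((Metric.closedBall (0 : (ℝ ∙ u)ᗮ) R).indicator fun _ => M) ?_ ?_ ?_ ?_
  · refine Filter.Eventually.of_forall fun s => ?_
    have hcl : IsClosed {z : (ℝ ∙ u)ᗮ | slicePoint u (s, z) ∈ K} :=
      hK.isClosed.preimage (isometry_slicePoint u s).continuous
    have hcon : ContinuousOn (fun z : (ℝ ∙ u)ᗮ => ρ (slicePoint u (s, z)))
        {z : (ℝ ∙ u)ᗮ | slicePoint u (s, z) ∈ K} :=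
      hρ.comp (isometry_slicePoint u s).continuous.continuousOn fun z hz => hz
    have := (aestronglyMeasurable_indicator_iff (μ := volume) hcl.measurableSet).2
      (hcon.aestronglyMeasurable hcl.measurableSet)
    exact this
  · refine Filter.Eventually.of_forall fun s => Filter.Eventually.of_forall fun z => ?_
    by_cases hz : slicePoint u (s, z) ∈ K
    · rw [indicator_of_mem hz, indicator_of_mem]
      · exact hM _ hz
      · simpa using (norm_le_norm_slicePoint (s, z)).trans (hR _ hz)
    · rw [indicator_of_notMem hz, norm_zero]
      exact indicator_nonneg (fun _ _ => hM0) _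
  · exact (integrable_indicator_iff measurableSet_closedBall).2
      (integrableOn_const (measure_closedBall_lt_top).ne)
  -- The slice is convex, so its frontier is null and may be discarded. Over an interior point,
  -- small upward moves stay in `K`; over a point outside, they stay outside because `K` is closed.
  · have hconv : Convex ℝ {z : (ℝ ∙ u)ᗮ | slicePoint u (a, z) ∈ K} := by
      intro z hz z' hz' α β hα hβ hαβ
      have := hKc hz hz' hα hβ hαβ
      have ha : a = α * a + β * a := by rw [← add_mul, hαβ, one_mul]
      simp only [slicePoint, mem_ofPred_eq, Submodule.coe_add, Submodule.coe_smul] at this ⊢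
      convert this using 1
      conv_lhs => rw [ha]
      module
    filter_upwards [measure_eq_zero_iff_ae_notMem.1 (hconv.addHaar_frontier volume)] with z hz
    have hcon : Continuous fun s : ℝ => slicePoint u (s, z) :=
      (continuous_slicePoint u).comp (by fun_prop)
    by_cases hzK : slicePoint u (a, z) ∈ K
    · have hzi : z ∈ interior {z : (ℝ ∙ u)ᗮ | slicePoint u (a, z) ∈ K} := by
        by_contra hzi
        exact hz ⟨subset_closure hzK, hzi⟩
      have hev := eventually_slicePoint_mem hKc hay₀ hy₀ hzi
      rw [indicator_of_mem hzK]
      have hlim : Filter.Tendsto (fun s : ℝ => slicePoint u (s, z)) (𝓝[≥] a)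
          (𝓝[K] (slicePoint u (a, z))) :=
        tendsto_nhdsWithin_iff.2 ⟨hcon.continuousWithinAt, hev⟩
      refine ((hρ _ hzK).tendsto.comp hlim).congr' ?_
      filter_upwards [hev] with s hs
      rw [indicator_of_mem hs, Function.comp]
    · rw [indicator_of_notMem hzK]
      refine tendsto_const_nhds.congr' ?_
      have : ∀ᶠ s in 𝓝 a, slicePoint u (s, z) ∈ Kᶜ :=
        hcon.continuousAt.eventually (hK.isClosed.isOpen_compl.mem_nhds hzK)
      filter_upwards [mem_nhdsWithin_of_mem_nhds this] with s hs
      rw [indicator_of_notMem hs]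

/-- The integral of a continuous function over the part of a compact convex set above a moving
hyperplane has minus the integral over the slice as right derivative. -/
theorem hasDerivWithinAt_setIntegral_halfspace {u : V} (hu : ‖u‖ = 1) {K : Set V}
    (hK : IsCompact K) (hKc : Convex ℝ K) {ρ : V → ℝ} (hρ : ContinuousOn ρ K) {a : ℝ}
    (hle : ∀ y ∈ K, a ≤ inner ℝ u y) (hne : ∃ y ∈ K, a < inner ℝ u y) :
    HasDerivWithinAt (fun t : ℝ => ∫ y in K ∩ {y | t ≤ inner ℝ u y}, ρ y)
      (-∫ y in K ∩ {y | inner ℝ u y = a}, ρ y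
        ∂(Measure.euclideanHausdorffMeasure (Module.finrank ℝ V - 1))) (Ici a) a := by
  have hf : Integrable (K.indicator ρ) := integrable_indicator_of_continuousOn hK hρ
  have hS := integrable_integral_slicePoint hu hf
  set S : ℝ → ℝ := fun s => ∫ z : (ℝ ∙ u)ᗮ, K.indicator ρ (slicePoint u (s, z)) with hSdef
  have hcont : ContinuousWithinAt S (Ici a) a :=
    continuousWithinAt_integral_slicePoint hu hK hKc hρ hne
  rw [setIntegral_slice hu hK.measurableSet]
  have hS0 : ∀ s < a, S s = 0 := by
    intro s hs
    refine integral_eq_zero_of_ae (Filter.Eventually.of_forall fun z => ?_)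
    refine indicator_of_notMem (fun hz => ?_) _
    have := hle _ hz
    rw [inner_slicePoint hu] at this
    exact absurd this (not_le.2 hs)
  -- With the total integral split off, only a primitive of `S` depends on t, and the fundamental
  -- theorem of calculus needs just right-continuity at a.
  have hsum : ∀ t, a ≤ t → ∫ y in K ∩ {y | t ≤ inner ℝ u y}, ρ y =
      (∫ s, S s) - ∫ s in a..t, S s := by
    intro t ht
    have hmeas : MeasurableSet {y : V | t ≤ inner ℝ u y} :=
      measurableSet_le measurable_const (by fun_prop)
    have h1 : ∫ y in K ∩ {y | t ≤ inner ℝ u y}, ρ y = ∫ s in Ici t, S s := by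
      rw [← integral_indicator (hK.measurableSet.inter hmeas), inter_comm, ← indicator_indicator,
        integral_eq_integral_integral_slicePoint hu (hf.indicator hmeas),
        ← integral_indicator measurableSet_Ici]
      refine integral_congr_ae (Filter.Eventually.of_forall fun s => ?_)
      by_cases hs : t ≤ s
      · rw [indicator_of_mem (show s ∈ Ici t from hs)]
        refine integral_congr_ae (Filter.Eventually.of_forall fun z => ?_)
        exact indicator_of_mem (by simpa [inner_slicePoint hu] using hs) _
      · rw [indicator_of_notMem (show s ∉ Ici t from hs)]
        refine integral_eq_zero_of_ae (Filter.Eventually.of_forall fun z => ?_)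
        exact indicator_of_notMem (by simpa [inner_slicePoint hu] using hs) _
    have h2 : ∫ s, S s = ∫ s in Ici a, S s := by
      rw [← integral_indicator measurableSet_Ici]
      refine integral_congr_ae (Filter.Eventually.of_forall fun s => ?_)
      by_cases hs : a ≤ s
      · rw [indicator_of_mem (show s ∈ Ici a from hs)]
      · rw [indicator_of_notMem (show s ∉ Ici a from hs), hS0 s (not_le.1 hs)]
    rw [h1, h2, integral_Ici_eq_integral_Ioi, integral_Ici_eq_integral_Ioi,
      ← intervalIntegral.integral_Ioi_sub_Ioi hS.integrableOn ht]
    ring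
  have hderiv : HasDerivWithinAt (fun t => ∫ s in a..t, S s) (S a) (Ici a) a :=
    intervalIntegral.integral_hasDerivWithinAt_right hS.intervalIntegrable
      hS.aestronglyMeasurable.stronglyMeasurableAtFilter (hcont.mono Ioi_subset_Ici_self)
  exact (hderiv.const_sub (∫ s, S s)).congr (fun t ht => hsum t ht) (hsum a le_rfl)

end Slicing

theorem IsCompactConvexPolyhedron.convex {d : ℕ} {Ω : Set (EuclideanSpace ℝ (Fin d))}
    (h : IsCompactConvexPolyhedron Ω) : Convex ℝ Ω := by
  obtain ⟨-, H, rfl⟩ := h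
  have : {y | ∀ h ∈ H, inner ℝ h.1 y ≤ h.2} =
      ⋂ h ∈ H, {y : EuclideanSpace ℝ (Fin d) | inner ℝ h.1 y ≤ h.2} := by
    ext y
    simp
  rw [this]
  exact convex_iInter₂ fun h _ => convex_halfSpace_le (innerₗ _ h.1).isLinear h.2

/-! ### Geometry of the Laguerre cells -/

section Cells

variable {d n : ℕ} {Ω : Set (EuclideanSpace ℝ (Fin d))} {x : Fin n → EuclideanSpace ℝ (Fin d)}
  {ψ φ : EuclideanSpace ℝ (Fin n)} {i j : Fin n}

/-- The unit vector pointing from the site `x i` to the site `x j`. -/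
noncomputable def siteDirection (x : Fin n → EuclideanSpace ℝ (Fin d)) (i j : Fin n) :
    EuclideanSpace ℝ (Fin d) := ‖x i - x j‖⁻¹ • (x j - x i)

/-- The height, in the direction from `x i` to `x j`, of the hyperplane separating the cells
of `x i` and `x j`. -/
noncomputable def siteThreshold (x : Fin n → EuclideanSpace ℝ (Fin d))
    (ψ : EuclideanSpace ℝ (Fin n)) (i j : Fin n) : ℝ :=
  (ψ i - ψ j + ‖x j‖ ^ 2 - ‖x i‖ ^ 2) / (2 * ‖x i - x j‖)

theorem norm_siteDirection (h : x i ≠ x j) : ‖siteDirection x i j‖ = 1 := by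
  have : ‖x i - x j‖ ≠ 0 := norm_ne_zero_iff.2 (sub_ne_zero.2 h)
  rw [siteDirection, norm_smul, norm_inv, norm_norm, norm_sub_rev (x j), inv_mul_cancel₀ this]

/-- The terms ‖y‖² cancel, so comparing two costs is an affine condition on y. -/
theorem cost_sub_cost (h : x i ≠ x j) (y : EuclideanSpace ℝ (Fin d)) :
    (‖y - x i‖ ^ 2 - ψ i) - (‖y - x j‖ ^ 2 - ψ j) =
      2 * ‖x i - x j‖ * (inner ℝ (siteDirection x i j) y - siteThreshold x ψ i j) := by
  have hne : ‖x i - x j‖ ≠ 0 := norm_ne_zero_iff.2 (sub_ne_zero.2 h)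
  rw [siteDirection, siteThreshold, real_inner_smul_left, inner_sub_left, norm_sub_sq_real,
    norm_sub_sq_real, real_inner_comm (x i) y, real_inner_comm (x j) y]
  field_simp
  ring

theorem cost_le_cost_iff (h : x i ≠ x j) (y : EuclideanSpace ℝ (Fin d)) :
    ‖y - x i‖ ^ 2 - ψ i ≤ ‖y - x j‖ ^ 2 - ψ j ↔
      inner ℝ (siteDirection x i j) y ≤ siteThreshold x ψ i j := by
  have hpos : 0 < 2 * ‖x i - x j‖ := by
    have := norm_pos_iff.2 (sub_ne_zero.2 h)
    positivity
  rw [← sub_nonpos, cost_sub_cost h, ← sub_nonpos (a := inner ℝ _ _)]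
  exact ⟨fun h => nonpos_of_mul_nonpos_right h hpos,
    fun h => mul_nonpos_of_nonneg_of_nonpos hpos.le h⟩

theorem cost_le_cost_iff' (h : x i ≠ x j) (y : EuclideanSpace ℝ (Fin d)) :
    ‖y - x j‖ ^ 2 - ψ j ≤ ‖y - x i‖ ^ 2 - ψ i ↔
      siteThreshold x ψ i j ≤ inner ℝ (siteDirection x i j) y := by
  have hpos : 0 < 2 * ‖x i - x j‖ := by
    have := norm_pos_iff.2 (sub_ne_zero.2 h)
    positivity
  rw [← sub_nonneg, cost_sub_cost h, ← sub_nonneg (b := siteThreshold x ψ i j)]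
  exact mul_nonneg_iff_of_pos_left hpos

theorem laguerreCell_subset : laguerreCell Ω x ψ i ⊆ Ω := fun _ hy => hy.1

theorem isClosed_laguerreCell (hΩ : IsClosed Ω) : IsClosed (laguerreCell Ω x ψ i) := by
  have : laguerreCell Ω x ψ i =
      Ω ∩ ⋂ j, ⋂ _ : j ≠ i, {y | ‖y - x i‖ ^ 2 - ψ i ≤ ‖y - x j‖ ^ 2 - ψ j} := by
    ext y
    simp [laguerreCell]
  rw [this]
  exact hΩ.inter (isClosed_iInter fun j => isClosed_iInter fun _ =>
    isClosed_le (by fun_prop) (by fun_prop))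

theorem isCompact_laguerreCell (hΩ : IsCompact Ω) : IsCompact (laguerreCell Ω x ψ i) :=
  hΩ.of_isClosed_subset (isClosed_laguerreCell hΩ.isClosed) laguerreCell_subset

theorem convex_laguerreCell (hΩ : Convex ℝ Ω) (hx : Function.Injective x) :
    Convex ℝ (laguerreCell Ω x ψ i) := by
  have : laguerreCell Ω x ψ i = Ω ∩ ⋂ j, ⋂ _ : j ≠ i,
      {y | inner ℝ (siteDirection x i j) y ≤ siteThreshold x ψ i j} := by
    ext y
    simp only [laguerreCell, mem_ofPred_eq, mem_inter_iff, mem_iInter]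
    exact and_congr_right fun _ => forall₂_congr fun j hj => cost_le_cost_iff (hx.ne hj.symm) y
  rw [this]
  exact hΩ.inter (convex_iInter fun j => convex_iInter fun _ =>
    convex_halfSpace_le (innerₗ _ _).isLinear _)

theorem iUnion_laguerreCell [Nonempty (Fin n)] : ⋃ i, laguerreCell Ω x ψ i = Ω := by
  refine subset_antisymm (iUnion_subset fun i => laguerreCell_subset) fun y hy => ?_
  obtain ⟨i, hi⟩ := Finite.exists_min fun i => ‖y - x i‖ ^ 2 - ψ i
  exact mem_iUnion.2 ⟨i, hy, fun j _ => hi j⟩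

/-- On the hyperplane the two costs agree, so minimality passes from j to i. The common face thus
becomes the extreme slice of the single convex set to which the slicing results apply. -/
theorem laguerreCell_inter_laguerreCell (hx : Function.Injective x) (hij : i ≠ j) :
    laguerreCell Ω x ψ i ∩ laguerreCell Ω x ψ j = laguerreCell Ω x ψ j ∩
      {y | inner ℝ (siteDirection x i j) y = siteThreshold x ψ i j} := by
  have h := hx.ne hij
  ext y
  refine ⟨fun hy => ⟨hy.2, le_antisymm ((cost_le_cost_iff h y).1 (hy.1.2 j hij.symm))
    ((cost_le_cost_iff' h y).1 (hy.2.2 i hij))⟩, fun hy => ⟨⟨hy.1.1, fun k hk => ?_⟩, hy.1⟩⟩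
  have h1 := (cost_le_cost_iff (ψ := ψ) h y).2 (le_of_eq hy.2)
  by_cases hkj : k = j
  · rw [hkj]
    exact h1
  · exact h1.trans (hy.1.2 k hkj)

theorem siteThreshold_le_of_mem (hx : Function.Injective x) (hij : i ≠ j)
    {y : EuclideanSpace ℝ (Fin d)} (hy : y ∈ laguerreCell Ω x ψ j) :
    siteThreshold x ψ i j ≤ inner ℝ (siteDirection x i j) y :=
  (cost_le_cost_iff' (hx.ne hij) y).1 (hy.2 i hij)

theorem le_siteThreshold_of_mem (hx : Function.Injective x) (hij : i ≠ j)
    {y : EuclideanSpace ℝ (Fin d)} (hy : y ∈ laguerreCell Ω x ψ i) :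
    inner ℝ (siteDirection x i j) y ≤ siteThreshold x ψ i j :=
  (cost_le_cost_iff (hx.ne hij) y).1 (hy.2 j hij.symm)

theorem volume_siteHyperplane (hx : Function.Injective x) (hij : i ≠ j) (a : ℝ) :
    volume {y | inner ℝ (siteDirection x i j) y = a} = 0 := by
  refine volume_hyperplane (fun h0 => ?_) a
  have := norm_siteDirection (hx.ne hij)
  simp [h0] at this

theorem volume_laguerreCell_inter (hx : Function.Injective x) (hij : i ≠ j) :
    volume (laguerreCell Ω x ψ i ∩ laguerreCell Ω x ψ j) = 0 := by
  rw [laguerreCell_inter_laguerreCell hx hij]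
  exact measure_mono_null inter_subset_right (volume_siteHyperplane hx hij _)

/-- A point of a half-space on its bounding hyperplane is not interior to a subset. -/
theorem notMem_interior_of_inner_eq {V : Type*} [NormedAddCommGroup V] [InnerProductSpace ℝ V]
    {u y : V} (hu : u ≠ 0) {K : Set V} (hK : ∀ z ∈ K, inner ℝ u z ≤ inner ℝ u y) :
    y ∉ interior K := by
  intro hy
  have hcont : ContinuousAt (fun t : ℝ => y + t • u) 0 := by fun_prop
  have h : ∀ᶠ t in 𝓝 (0 : ℝ), y + t • u ∈ K :=
    hcont.eventually (by simpa using mem_interior_iff_mem_nhds.1 hy)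
  obtain ⟨t, ht, ht0⟩ := ((h.filter_mono nhdsWithin_le_nhds).and
    (self_mem_nhdsWithin (s := Ioi (0 : ℝ)))).exists
  have := hK _ ht
  rw [inner_add_right, inner_smul_right, real_inner_self_eq_norm_sq] at this
  have : 0 < t * ‖u‖ ^ 2 := mul_pos ht0 (pow_pos (norm_pos_iff.2 hu) 2)
  linarith

/-- The cells lie on opposite sides of the separating hyperplane, so a common point is interior to
neither; the converse inclusion is closedness. -/
theorem frontier_inter_frontier_laguerreCell (hΩ : IsClosed Ω) (hx : Function.Injective x)
    (hij : i ≠ j) :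
    frontier (laguerreCell Ω x ψ i) ∩ frontier (laguerreCell Ω x ψ j) =
      laguerreCell Ω x ψ i ∩ laguerreCell Ω x ψ j := by
  have hne : ∀ {k l : Fin n}, k ≠ l → siteDirection x k l ≠ 0 := fun hkl h0 => by
    have := norm_siteDirection (hx.ne hkl)
    simp [h0] at this
  have key : ∀ {k l : Fin n}, k ≠ l → laguerreCell Ω x ψ k ∩ laguerreCell Ω x ψ l ⊆
      frontier (laguerreCell Ω x ψ k) := by
    intro k l hkl y hy
    refine ⟨subset_closure hy.1, notMem_interior_of_inner_eq (hne hkl) fun z hz => ?_⟩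
    exact (le_siteThreshold_of_mem hx hkl hz).trans (siteThreshold_le_of_mem hx hkl hy.2)
  refine subset_antisymm (inter_subset_inter ?_ ?_) (subset_inter (key hij) ?_)
  · exact (isClosed_laguerreCell hΩ).frontier_subset
  · exact (isClosed_laguerreCell hΩ).frontier_subset
  · rw [inter_comm]
    exact key hij.symm

/-! ### The pointwise minimum of the shifted costs -/

theorem abs_apply_sub_le (ψ φ : EuclideanSpace ℝ (Fin n)) (i : Fin n) : |φ i - ψ i| ≤ ‖φ - ψ‖ := by
  simpa using PiLp.norm_apply_le (φ - ψ) i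

/-- The negative of a coordinate functional. -/
noncomputable def negCoord (i : Fin n) : EuclideanSpace ℝ (Fin n) →L[ℝ] ℝ :=
  -EuclideanSpace.proj i

theorem negCoord_apply (i : Fin n) (ψ : EuclideanSpace ℝ (Fin n)) : negCoord i ψ = -ψ i := rfl

/-- The minimal value of the shifted costs, as a function of the weights and of the point. -/
noncomputable def minCost [Nonempty (Fin n)] (x : Fin n → EuclideanSpace ℝ (Fin d))
    (ψ : EuclideanSpace ℝ (Fin n)) (y : EuclideanSpace ℝ (Fin d)) : ℝ :=
  Finset.univ.inf' Finset.univ_nonempty fun i => ‖x i - y‖ ^ 2 - ψ i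

section MinCost

variable [Nonempty (Fin n)]

theorem minCost_le (y : EuclideanSpace ℝ (Fin d)) (i : Fin n) :
    minCost x ψ y ≤ ‖x i - y‖ ^ 2 - ψ i :=
  Finset.inf'_le (fun i => ‖x i - y‖ ^ 2 - ψ i) (Finset.mem_univ i)

theorem le_minCost {y : EuclideanSpace ℝ (Fin d)} {a : ℝ} (h : ∀ i, a ≤ ‖x i - y‖ ^ 2 - ψ i) :
    a ≤ minCost x ψ y :=
  Finset.le_inf' _ _ fun i _ => h i

theorem continuous_minCost : Continuous (minCost x ψ) :=
  Continuous.finset_inf'_apply _ fun i _ => by fun_prop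

theorem minCost_eq_of_mem {y : EuclideanSpace ℝ (Fin d)} (hy : y ∈ laguerreCell Ω x ψ i) :
    minCost x ψ y = ‖x i - y‖ ^ 2 - ψ i := by
  refine le_antisymm (minCost_le y i) (le_minCost fun j => ?_)
  rw [norm_sub_rev (x i), norm_sub_rev (x j)]
  by_cases hj : j = i
  · rw [hj]
  · exact hy.2 j hj

theorem minCost_sub_le (y : EuclideanSpace ℝ (Fin d)) :
    minCost x φ y - minCost x ψ y ≤ ‖φ - ψ‖ := by
  rw [sub_le_iff_le_add, ← sub_le_iff_le_add']
  refine le_minCost fun i => ?_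
  have h1 := minCost_le (x := x) (ψ := φ) y i
  have h2 := (abs_le.1 (abs_apply_sub_le ψ φ i)).1
  linarith

theorem norm_minCost_sub_le (y : EuclideanSpace ℝ (Fin d)) :
    ‖minCost x φ y - minCost x ψ y‖ ≤ ‖φ - ψ‖ := by
  rw [Real.norm_eq_abs, abs_le']
  refine ⟨minCost_sub_le y, ?_⟩
  rw [neg_sub, norm_sub_rev]
  exact minCost_sub_le y

theorem minCost_concave (y : EuclideanSpace ℝ (Fin d)) {a b : ℝ} (ha : 0 ≤ a) (hb : 0 ≤ b)
    (hab : a + b = 1) :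
    a * minCost x ψ y + b * minCost x φ y ≤ minCost x (a • ψ + b • φ) y := by
  refine le_minCost fun i => ?_
  have h1 := mul_le_mul_of_nonneg_left (minCost_le (x := x) (ψ := ψ) y i) ha
  have h2 := mul_le_mul_of_nonneg_left (minCost_le (x := x) (ψ := φ) y i) hb
  have h3 : ‖x i - y‖ ^ 2 = a * ‖x i - y‖ ^ 2 + b * ‖x i - y‖ ^ 2 := by
    rw [← add_mul, hab, one_mul]
  simp only [PiLp.add_apply, PiLp.smul_apply, smul_eq_mul]
  linarith

/-- Away from the other cells, the minimal cost is locally given by one site. -/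
theorem hasFDerivAt_minCost {y : EuclideanSpace ℝ (Fin d)} (hy : y ∈ laguerreCell Ω x ψ i)
    (hy' : ∀ j, j ≠ i → y ∉ laguerreCell Ω x ψ j) :
    HasFDerivAt (fun φ => minCost x φ y) (negCoord i) ψ := by
  have hlt : ∀ j, j ≠ i → ‖y - x i‖ ^ 2 - ψ i < ‖y - x j‖ ^ 2 - ψ j := by
    intro j hj
    -- A tie would make j a minimiser too and put y in its cell.
    refine lt_of_le_of_ne (hy.2 j hj) fun heq => hy' j hj ⟨hy.1, fun k hk => ?_⟩
    rw [← heq]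
    by_cases hki : k = i
    · rw [hki]
    · exact hy.2 k hki
  have hev : ∀ᶠ φ : EuclideanSpace ℝ (Fin n) in 𝓝 ψ, ∀ j, j ≠ i →
      ‖y - x i‖ ^ 2 - φ i < ‖y - x j‖ ^ 2 - φ j := by
    refine Filter.eventually_all.2 fun j => ?_
    by_cases hj : j = i
    · exact Filter.Eventually.of_forall fun φ h => absurd hj h
    · have hc1 : Continuous fun φ : EuclideanSpace ℝ (Fin n) => ‖y - x i‖ ^ 2 - φ i := by fun_prop
      have hc2 : Continuous fun φ : EuclideanSpace ℝ (Fin n) => ‖y - x j‖ ^ 2 - φ j := by fun_prop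
      exact (hc1.continuousAt.eventually_lt hc2.continuousAt (hlt j hj)).mono fun φ h _ => h
  have hder : HasFDerivAt (fun φ : EuclideanSpace ℝ (Fin n) => ‖x i - y‖ ^ 2 - φ i)
      (negCoord i) ψ :=
    (EuclideanSpace.proj i : EuclideanSpace ℝ (Fin n) →L[ℝ] ℝ).hasFDerivAt.const_sub _
  refine hder.congr_of_eventuallyEq (hev.mono fun φ hφ => ?_)
  exact minCost_eq_of_mem (Ω := Ω) ⟨hy.1, fun j hj => (hφ j hj).le⟩

end MinCost

end Cells

/-! ### Concavity, gradient and Lipschitz bound -/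

section Dual

variable {d n : ℕ} {Ω : Set (EuclideanSpace ℝ (Fin d))} {x : Fin n → EuclideanSpace ℝ (Fin d)}
  {ψ φ : EuclideanSpace ℝ (Fin n)} {i j : Fin n} {μ : Measure (EuclideanSpace ℝ (Fin d))}

theorem aedisjoint_laguerreCell (hμ : μ ≪ volume) (hx : Function.Injective x) :
    Pairwise (Function.onFun (AEDisjoint μ) (laguerreCell Ω x ψ)) := fun _ _ hij =>
  hμ (volume_laguerreCell_inter hx hij)

theorem sum_measureReal_laguerreCell [Nonempty (Fin n)] [IsProbabilityMeasure μ]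
    (hΩ : IsClosed Ω) (hμΩ : ∀ᵐ y ∂μ, y ∈ Ω) (hμ : μ ≪ volume) (hx : Function.Injective x) :
    ∑ i, μ.real (laguerreCell Ω x ψ i) = 1 := by
  have h := measure_iUnion₀ (aedisjoint_laguerreCell (Ω := Ω) (ψ := ψ) hμ hx)
    fun i => (isClosed_laguerreCell hΩ).measurableSet.nullMeasurableSet
  rw [iUnion_laguerreCell, tsum_fintype, prob_compl_eq_zero_iff hΩ.measurableSet |>.1 hμΩ] at h
  simp only [Measure.real]
  rw [← ENNReal.toReal_sum fun i _ => measure_ne_top _ _, ← h, ENNReal.toReal_one]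

theorem integrable_minCost [Nonempty (Fin n)] [IsFiniteMeasure μ] (hΩ : IsCompact Ω)
    (hμΩ : ∀ᵐ y ∂μ, y ∈ Ω) : Integrable (minCost x ψ) μ := by
  have h := continuous_minCost (x := x) (ψ := ψ) |>.continuousOn.integrableOn_compact (μ := μ) hΩ
  rwa [IntegrableOn, Measure.restrict_eq_self_of_ae_mem hμΩ] at h

theorem dualFunction_eq [Nonempty (Fin n)] [IsFiniteMeasure μ] (hΩ : IsCompact Ω)
    (hμΩ : ∀ᵐ y ∂μ, y ∈ Ω) (hμ : μ ≪ volume) (hx : Function.Injective x) (w : Fin n → ℝ)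
    (ψ : EuclideanSpace ℝ (Fin n)) :
    dualFunction Ω μ x w ψ = ∫ y, minCost x ψ y ∂μ + ∑ i, ψ i * w i := by
  rw [dualFunction]
  congr 1
  have hm : ∀ i, MeasurableSet (laguerreCell Ω x ψ i) := fun i =>
    (isClosed_laguerreCell hΩ.isClosed).measurableSet
  have h := integral_iUnion_ae (f := minCost x ψ) (fun i => (hm i).nullMeasurableSet)
    (aedisjoint_laguerreCell (Ω := Ω) (ψ := ψ) hμ hx) (integrable_minCost hΩ hμΩ).integrableOn
  rw [iUnion_laguerreCell, Measure.restrict_eq_self_of_ae_mem hμΩ, tsum_fintype] at h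
  rw [h]
  exact Finset.sum_congr rfl fun i _ =>
    setIntegral_congr_fun (hm i) fun y hy => (minCost_eq_of_mem hy).symm

theorem concaveOn_dualFunction [Nonempty (Fin n)] [IsFiniteMeasure μ] (hΩ : IsCompact Ω)
    (hμΩ : ∀ᵐ y ∂μ, y ∈ Ω) (hμ : μ ≪ volume) (hx : Function.Injective x) (w : Fin n → ℝ) :
    ConcaveOn ℝ univ (dualFunction Ω μ x w) := by
  refine ⟨convex_univ, fun ψ _ φ _ a b ha hb hab => ?_⟩
  simp only [dualFunction_eq hΩ hμΩ hμ hx w, smul_eq_mul]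
  have hi : ∀ ψ, Integrable (minCost x ψ) μ := fun ψ => integrable_minCost hΩ hμΩ
  have h := integral_mono (((hi ψ).const_mul a).add ((hi φ).const_mul b)) (hi (a • ψ + b • φ))
    fun y => minCost_concave y ha hb hab
  simp only [Pi.add_apply] at h
  rw [integral_add ((hi ψ).const_mul a) ((hi φ).const_mul b), integral_const_mul,
    integral_const_mul] at h
  have hsum : ∑ i, (a • ψ + b • φ) i * w i = a * ∑ i, ψ i * w i + b * ∑ i, φ i * w i := by
    rw [Finset.mul_sum, Finset.mul_sum, ← Finset.sum_add_distrib]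
    refine Finset.sum_congr rfl fun i _ => ?_
    simp only [PiLp.add_apply, PiLp.smul_apply, smul_eq_mul]
    ring
  rw [hsum]
  linarith

theorem integrable_sum_indicator_const {α ι G : Type*} [MeasurableSpace α] [Fintype ι]
    [NormedAddCommGroup G] {ν : Measure α} [IsFiniteMeasure ν] {s : ι → Set α}
    (hs : ∀ i, MeasurableSet (s i)) (c : ι → G) :
    Integrable (fun y => ∑ i, (s i).indicator (fun _ => c i) y) ν :=
  integrable_finsetSum _ fun i _ => (integrable_const (c i)).indicator (hs i)

theorem integral_sum_indicator_const {α ι G : Type*} [MeasurableSpace α] [Fintype ι]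
    [NormedAddCommGroup G] [NormedSpace ℝ G] [CompleteSpace G] {ν : Measure α} [IsFiniteMeasure ν]
    {s : ι → Set α} (hs : ∀ i, MeasurableSet (s i)) (c : ι → G) :
    ∫ y, ∑ i, (s i).indicator (fun _ => c i) y ∂ν = ∑ i, ν.real (s i) • c i := by
  rw [integral_finsetSum _ fun i _ => (integrable_const (c i)).indicator (hs i)]
  exact Finset.sum_congr rfl fun i _ => integral_indicator_const _ (hs i)

/-- Dominated differentiation: the Lipschitz constant 1 in ψ is the integrable bound, and the points
lying in two cells, where differentiability may fail, are μ-null. -/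
theorem hasFDerivAt_integral_minCost [Nonempty (Fin n)] [IsFiniteMeasure μ] (hΩ : IsCompact Ω)
    (hμΩ : ∀ᵐ y ∂μ, y ∈ Ω) (hμ : μ ≪ volume) (hx : Function.Injective x)
    (ψ : EuclideanSpace ℝ (Fin n)) :
    HasFDerivAt (fun φ => ∫ y, minCost x φ y ∂μ)
      (∑ i, μ.real (laguerreCell Ω x ψ i) • negCoord i) ψ := by
  have hm : ∀ i, MeasurableSet (laguerreCell Ω x ψ i) := fun i =>
    (isClosed_laguerreCell hΩ.isClosed).measurableSet
  let F' : EuclideanSpace ℝ (Fin d) → EuclideanSpace ℝ (Fin n) →L[ℝ] ℝ := fun y =>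
    ∑ i, (laguerreCell Ω x ψ i).indicator (fun _ => negCoord i) y
  have hdisj : ∀ᵐ y ∂μ, ∀ i j, i ≠ j → ¬ (y ∈ laguerreCell Ω x ψ i ∧ y ∈ laguerreCell Ω x ψ j) := by
    refine ae_all_iff.2 fun i => ae_all_iff.2 fun j => ?_
    by_cases hij : i = j
    · simp [hij]
    · filter_upwards [measure_eq_zero_iff_ae_notMem.1
        (hμ (volume_laguerreCell_inter (Ω := Ω) (ψ := ψ) hx hij))] with y hy _ using hy
  have hF'i : Integrable F' μ := integrable_sum_indicator_const hm negCoord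
  rw [← integral_sum_indicator_const hm negCoord]
  have hlip : ∀ᵐ y ∂μ, ∀ φ ∈ univ, ‖minCost x φ y - minCost x ψ y‖ ≤ 1 * ‖φ - ψ‖ :=
    Filter.Eventually.of_forall fun y φ _ => by
      rw [one_mul]
      exact norm_minCost_sub_le y
  have hdiff : ∀ᵐ y ∂μ, HasFDerivAt (fun φ => minCost x φ y) (F' y) ψ := by
    filter_upwards [hμΩ, hdisj] with y hy hyd
    rw [← iUnion_laguerreCell (Ω := Ω) (x := x) (ψ := ψ)] at hy
    obtain ⟨i, hi⟩ := mem_iUnion.1 hy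
    have hne : ∀ j, j ≠ i → y ∉ laguerreCell Ω x ψ j := fun j hj hyj => hyd i j hj.symm ⟨hi, hyj⟩
    have hFy : F' y = negCoord i := by
      simp only [F']
      rw [Finset.sum_eq_single i (fun j _ hj => indicator_of_notMem (hne j hj) _) (by simp),
        indicator_of_mem hi]
    rw [hFy]
    exact hasFDerivAt_minCost hi hne
  exact (hasFDerivAt_integral_of_dominated_loc_of_lip' (F := fun φ y => minCost x φ y)
    (bound := fun _ => 1) Filter.univ_mem
    (fun φ _ => continuous_minCost.aestronglyMeasurable) (integrable_minCost hΩ hμΩ)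
    hF'i.aestronglyMeasurable hlip
    (integrable_const _) hdiff).2

theorem hasGradientAt_dualFunction [Nonempty (Fin n)] [IsFiniteMeasure μ] (hΩ : IsCompact Ω)
    (hμΩ : ∀ᵐ y ∂μ, y ∈ Ω) (hμ : μ ≪ volume) (hx : Function.Injective x) (w : Fin n → ℝ)
    (ψ : EuclideanSpace ℝ (Fin n)) :
    HasGradientAt (dualFunction Ω μ x w)
      (WithLp.toLp 2 fun i => w i - μ.real (laguerreCell Ω x ψ i)) ψ := by
  rw [hasGradientAt_iff_hasFDerivAt, funext (dualFunction_eq hΩ hμΩ hμ hx w)]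
  have h2 : HasFDerivAt (fun φ : EuclideanSpace ℝ (Fin n) => ∑ i, φ i * w i)
      (∑ i, w i • (EuclideanSpace.proj i : EuclideanSpace ℝ (Fin n) →L[ℝ] ℝ)) ψ :=
    HasFDerivAt.fun_sum fun i _ =>
      (EuclideanSpace.proj i : EuclideanSpace ℝ (Fin n) →L[ℝ] ℝ).hasFDerivAt.mul_const (w i)
  convert! (hasFDerivAt_integral_minCost hΩ hμΩ hμ hx ψ).add h2 using 1
  ext v
  simp only [InnerProductSpace.toDual_apply_apply, PiLp.inner_apply, add_apply, sum_apply, smul_apply, negCoord_apply,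
    PiLp.proj_apply, RCLike.inner_apply, conj_trivial, smul_eq_mul, ← Finset.sum_add_distrib]
  exact Finset.sum_congr rfl fun i _ => by ring

theorem abs_siteThreshold_sub_le (hx : Function.Injective x) (hij : i ≠ j) :
    |siteThreshold x φ i j - siteThreshold x ψ i j| ≤ ‖x i - x j‖⁻¹ * ‖φ - ψ‖ := by
  have hpos : 0 < ‖x i - x j‖ := norm_pos_iff.2 (sub_ne_zero.2 (hx.ne hij))
  have h : siteThreshold x φ i j - siteThreshold x ψ i j =
      ‖x i - x j‖⁻¹ * (((φ i - ψ i) - (φ j - ψ j)) / 2) := by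
    rw [siteThreshold, siteThreshold]
    field_simp
    ring
  rw [h, abs_mul, abs_of_pos (inv_pos.2 hpos)]
  refine mul_le_mul_of_nonneg_left ?_ (inv_pos.2 hpos).le
  have h1 := abs_le.1 (abs_apply_sub_le ψ φ i)
  have h2 := abs_le.1 (abs_apply_sub_le ψ φ j)
  rw [abs_le]
  constructor <;> linarith

/-- For a bounded density, the measure of the part of a cell that is lost when the weights change
is controlled by the change of the weights. -/
theorem exists_measure_laguerreCell_diff_le (hΩ : IsCompact Ω) (hx : Function.Injective x)
    {c : ℝ≥0∞} (hc : c ≠ ∞) (hμ : μ ≤ c • volume) :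
    ∃ C : ℝ≥0, ∀ (φ ψ : EuclideanSpace ℝ (Fin n)) (i : Fin n),
      μ (laguerreCell Ω x φ i \ laguerreCell Ω x ψ i) ≤ ENNReal.ofReal (C * ‖φ - ψ‖) := by
  obtain ⟨R, hR⟩ := hΩ.isBounded.exists_norm_le
  -- Density bound, times the rate at which the hyperplane moves, times a bound for the area of its
  -- part inside `Ω`.
  let A : Fin n → Fin n → ℝ≥0∞ := fun i j => c * (ENNReal.ofReal ‖x i - x j‖⁻¹ *
    volume (Metric.closedBall (0 : (ℝ ∙ siteDirection x i j)ᗮ) R))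
  have hA : ∑ i, ∑ j, A i j ≠ ∞ := by
    refine ENNReal.sum_ne_top.2 fun i _ => ENNReal.sum_ne_top.2 fun j _ => ?_
    exact ENNReal.mul_ne_top hc
      (ENNReal.mul_ne_top ENNReal.ofReal_ne_top measure_closedBall_lt_top.ne)
  refine ⟨(∑ i, ∑ j, A i j).toNNReal, fun φ ψ i => ?_⟩
  -- A point outside the ψ-cell violates the constraint of some j, which holds for φ; it lies
  -- between the two positions of that hyperplane.
  have hsub : laguerreCell Ω x φ i \ laguerreCell Ω x ψ i ⊆ ⋃ j, ⋃ _ : j ≠ i,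
      {y | ‖y‖ ≤ R ∧ siteThreshold x ψ i j ≤ inner ℝ (siteDirection x i j) y ∧
        inner ℝ (siteDirection x i j) y ≤ siteThreshold x φ i j} := by
    rintro y ⟨hy, hyψ⟩
    have : ∃ j, j ≠ i ∧ ¬ (‖y - x i‖ ^ 2 - ψ i ≤ ‖y - x j‖ ^ 2 - ψ j) := by
      by_contra! hcon
      exact hyψ ⟨hy.1, hcon⟩
    obtain ⟨j, hj, hlt⟩ := this
    simp only [mem_iUnion]
    refine ⟨j, hj, hR y hy.1, ?_, le_siteThreshold_of_mem hx hj.symm hy⟩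
    exact (cost_le_cost_iff' (hx.ne hj.symm) y).1 (not_le.1 hlt).le
  have hslab : ∀ j, μ (⋃ _ : j ≠ i,
      {y | ‖y‖ ≤ R ∧ siteThreshold x ψ i j ≤ inner ℝ (siteDirection x i j) y ∧
        inner ℝ (siteDirection x i j) y ≤ siteThreshold x φ i j}) ≤
      A i j * ENNReal.ofReal ‖φ - ψ‖ := by
    intro j
    by_cases hj : j = i
    · simp [hj]
    · simp only [ne_eq, hj, not_false_eq_true, iUnion_true]
      have hj' : i ≠ j := fun h => hj h.symm
      refine (hμ _).trans ?_
      rw [Measure.smul_apply, smul_eq_mul]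
      have h1 := volume_slab_le (norm_siteDirection (hx.ne hj')) R (siteThreshold x ψ i j)
        (siteThreshold x φ i j)
      have h2 : ENNReal.ofReal (siteThreshold x φ i j - siteThreshold x ψ i j) ≤
          ENNReal.ofReal ‖x i - x j‖⁻¹ * ENNReal.ofReal ‖φ - ψ‖ := by
        rw [← ENNReal.ofReal_mul (by positivity)]
        exact ENNReal.ofReal_le_ofReal ((le_abs_self _).trans (abs_siteThreshold_sub_le hx hj'))
      calc _ ≤ c * (ENNReal.ofReal ‖x i - x j‖⁻¹ * ENNReal.ofReal ‖φ - ψ‖ *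
            volume (Metric.closedBall (0 : (ℝ ∙ siteDirection x i j)ᗮ) R)) := by
              gcongr
              exact h1.trans (by gcongr)
        _ = A i j * ENNReal.ofReal ‖φ - ψ‖ := by
              simp only [A]
              ring
  calc μ (laguerreCell Ω x φ i \ laguerreCell Ω x ψ i)
      ≤ ∑ j, A i j * ENNReal.ofReal ‖φ - ψ‖ :=
        (measure_mono hsub).trans ((measure_iUnion_fintype_le _ _).trans
          (Finset.sum_le_sum fun j _ => hslab j))
    _ ≤ (∑ i, ∑ j, A i j) * ENNReal.ofReal ‖φ - ψ‖ := by
        rw [← Finset.sum_mul]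
        refine mul_le_mul' ?_ le_rfl
        exact Finset.single_le_sum (f := fun i => ∑ j, A i j) (fun _ _ => zero_le)
          (Finset.mem_univ i)
    _ = ENNReal.ofReal ((∑ i, ∑ j, A i j).toNNReal * ‖φ - ψ‖) := by
        rw [ENNReal.ofReal_mul NNReal.zero_le_coe, ENNReal.ofReal_coe_nnreal,
          ENNReal.coe_toNNReal hA]

theorem exists_lipschitzWith_measureReal_laguerreCell [IsFiniteMeasure μ] (hΩ : IsCompact Ω)
    (hx : Function.Injective x) {c : ℝ≥0∞} (hc : c ≠ ∞) (hμ : μ ≤ c • volume) :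
    ∃ C : ℝ≥0, ∀ i, LipschitzWith C fun ψ => μ.real (laguerreCell Ω x ψ i) := by
  obtain ⟨C, hC⟩ := exists_measure_laguerreCell_diff_le hΩ hx hc hμ
  refine ⟨C, fun i => LipschitzWith.of_le_add_mul _ fun φ ψ => ?_⟩
  have h1 : μ.real (laguerreCell Ω x φ i) ≤ μ.real (laguerreCell Ω x ψ i) +
      μ.real (laguerreCell Ω x φ i \ laguerreCell Ω x ψ i) :=
    (measureReal_mono fun y hy => by
      by_cases h : y ∈ laguerreCell Ω x ψ i
      · exact Or.inl h
      · exact Or.inr ⟨hy, h⟩).trans (measureReal_union_le _ _)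
  have h2 : μ.real (laguerreCell Ω x φ i \ laguerreCell Ω x ψ i) ≤ C * ‖φ - ψ‖ :=
    ENNReal.toReal_le_of_le_ofReal (by positivity) (hC φ ψ i)
  rw [dist_eq_norm]
  linarith

theorem exists_lipschitzWith_gradient_dualFunction [Nonempty (Fin n)] [IsFiniteMeasure μ]
    (hΩ : IsCompact Ω) (hμΩ : ∀ᵐ y ∂μ, y ∈ Ω) (hx : Function.Injective x) (w : Fin n → ℝ)
    {c : ℝ≥0∞} (hc : c ≠ ∞) (hμ : μ ≤ c • volume) :
    ∃ K : ℝ≥0, LipschitzWith K (gradient (dualFunction Ω μ x w)) := by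
  obtain ⟨C, hC⟩ := exists_lipschitzWith_measureReal_laguerreCell hΩ hx hc hμ
  have hac : μ ≪ volume := Measure.absolutelyContinuous_of_le_smul hμ
  rw [gradient_eq (hasGradientAt_dualFunction hΩ hμΩ hac hx w)]
  have h1 : LipschitzWith C fun (ψ : EuclideanSpace ℝ (Fin n)) (i : Fin n) =>
      w i - μ.real (laguerreCell Ω x ψ i) := by
    refine LipschitzWith.of_dist_le_mul fun φ ψ => (dist_pi_le_iff (by positivity)).2 fun i => ?_
    rw [dist_sub_left]
    exact (hC i).dist_le_mul φ ψ
  exact ⟨_, (PiLp.lipschitzWith_toLp 2 fun _ : Fin n => ℝ).comp h1⟩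

end Dual

/-! ### Second derivatives -/

section SecondDerivative

variable {d n : ℕ} {Ω : Set (EuclideanSpace ℝ (Fin d))} {x : Fin n → EuclideanSpace ℝ (Fin d)}
  {ψ : EuclideanSpace ℝ (Fin n)} {i j : Fin n} {μ : Measure (EuclideanSpace ℝ (Fin d))}
  {ρ : EuclideanSpace ℝ (Fin d) → ℝ}

theorem measureReal_eq_setIntegral {α : Type*} [MeasurableSpace α] {ν : Measure α} {A S : Set α}
    {ρ : α → ℝ} (hS : MeasurableSet S) (hSA : S ⊆ A)
    (hρm : AEMeasurable ρ (ν.restrict A)) (hρ0 : ∀ y ∈ A, 0 ≤ ρ y) :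
    ((ν.restrict A).withDensity fun y => ENNReal.ofReal (ρ y)).real S = ∫ y in S, ρ y ∂ν := by
  have hr : (ν.restrict A).restrict S = ν.restrict S := by
    rw [Measure.restrict_restrict hS, inter_eq_left.2 hSA]
  rw [Measure.real, withDensity_apply _ hS, hr, integral_eq_lintegral_of_nonneg_ae]
  · exact (ae_restrict_mem hS).mono fun y hy => hρ0 y (hSA hy)
  · exact (hρm.mono_measure (Measure.restrict_mono hSA le_rfl)).aestronglyMeasurable

theorem siteThreshold_add_single (hij : i ≠ j) (t : ℝ) :
    siteThreshold x (ψ + t • EuclideanSpace.single i 1) i j =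
      siteThreshold x ψ i j + t / (2 * ‖x i - x j‖) := by
  have h : j ≠ i := hij.symm
  simp only [siteThreshold, PiLp.add_apply, PiLp.smul_apply, PiLp.single_apply, if_true, if_neg h,
    smul_eq_mul]
  ring

/-- Raising the weight of `x i` cuts a slab off the cell of `x j`. -/
theorem laguerreCell_add_single (hx : Function.Injective x) (hij : i ≠ j) {t : ℝ} (ht : 0 ≤ t) :
    laguerreCell Ω x (ψ + t • EuclideanSpace.single i 1) j = laguerreCell Ω x ψ j ∩
      {y | siteThreshold x ψ i j + t / (2 * ‖x i - x j‖) ≤ inner ℝ (siteDirection x i j) y} := by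
  have h := hx.ne hij
  have hi : (ψ + t • EuclideanSpace.single i (1 : ℝ)) i = ψ i + t := by simp
  have hk : ∀ k, k ≠ i → (ψ + t • EuclideanSpace.single i (1 : ℝ)) k = ψ k := fun k hk => by
    simp [hk]
  ext y
  rw [← siteThreshold_add_single hij]
  constructor
  · intro hy
    refine ⟨⟨hy.1, fun k hkj => ?_⟩, siteThreshold_le_of_mem hx hij hy⟩
    have h1 := hy.2 k hkj
    rw [hk j hij.symm] at h1
    by_cases hki : k = i
    · rw [hki] at h1 ⊢
      rw [hi] at h1
      linarith
    · rwa [hk k hki] at h1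
  · rintro ⟨hy, hyt⟩
    refine ⟨hy.1, fun k hkj => ?_⟩
    by_cases hki : k = i
    · rw [hki]
      exact (cost_le_cost_iff' h y).2 hyt
    · rw [hk j hij.symm, hk k hki]
      exact hy.2 k hkj

/-- The right derivative of the mass of the cell of `x j` in the weight of `x i`, if the cell is
not contained in the hyperplane that separates it from the cell of `x i`. -/
theorem hasDerivWithinAt_measureReal_laguerreCell (hΩ : IsCompact Ω) (hΩc : Convex ℝ Ω)
    (hx : Function.Injective x) (hρ : ContinuousOn ρ Ω) (hρ0 : ∀ y ∈ Ω, 0 ≤ ρ y)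
    (hμ : μ = (volume.restrict Ω).withDensity fun y => ENNReal.ofReal (ρ y)) (hij : i ≠ j)
    (hne : ∃ y ∈ laguerreCell Ω x ψ j,
      siteThreshold x ψ i j < inner ℝ (siteDirection x i j) y) :
    HasDerivWithinAt
      (fun t : ℝ => μ.real (laguerreCell Ω x (ψ + t • EuclideanSpace.single i 1) j))
      (-∫ y in laguerreCell Ω x ψ i ∩ laguerreCell Ω x ψ j, ρ y / (2 * ‖x i - x j‖)
        ∂(Measure.euclideanHausdorffMeasure (d - 1))) (Ici 0) 0 := by
  have hpos : 0 < 2 * ‖x i - x j‖ := by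
    have := norm_pos_iff.2 (sub_ne_zero.2 (hx.ne hij))
    positivity
  have hK : IsCompact (laguerreCell Ω x ψ j) := isCompact_laguerreCell hΩ
  have h := hasDerivWithinAt_setIntegral_halfspace (norm_siteDirection (hx.ne hij)) hK
    (convex_laguerreCell hΩc hx) (hρ.mono laguerreCell_subset)
    (fun y hy => siteThreshold_le_of_mem hx hij hy) hne
  rw [finrank_euclideanSpace_fin, ← laguerreCell_inter_laguerreCell hx hij] at h
  -- Height of the moving hyperplane; its speed supplies the factor 1 / (2‖x i - x j‖) through the
  -- chain rule.
  let l : ℝ → ℝ := fun t => siteThreshold x ψ i j + t / (2 * ‖x i - x j‖)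
  have hl0 : l 0 = siteThreshold x ψ i j := by simp [l]
  have hl : HasDerivWithinAt l (1 / (2 * ‖x i - x j‖)) (Ici 0) 0 :=
    (((hasDerivAt_id (0 : ℝ)).div_const _).const_add _).hasDerivWithinAt
  have hmaps : MapsTo l (Ici 0) (Ici (siteThreshold x ψ i j)) := fun t ht =>
    le_add_of_nonneg_right (div_nonneg ht hpos.le)
  rw [← hl0] at h hmaps
  have hcomp := h.comp (0 : ℝ) hl hmaps
  rw [integral_div, ← neg_div, div_eq_mul_one_div]
  have heq : ∀ t ∈ Ici (0 : ℝ),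
      μ.real (laguerreCell Ω x (ψ + t • EuclideanSpace.single i 1) j) =
      ∫ y in laguerreCell Ω x ψ j ∩ {y | l t ≤ inner ℝ (siteDirection x i j) y}, ρ y := by
    intro t ht
    rw [hμ, measureReal_eq_setIntegral
      (isClosed_laguerreCell hΩ.isClosed).measurableSet laguerreCell_subset
      (hρ.aemeasurable hΩ.measurableSet) hρ0, laguerreCell_add_single hx hij ht]
  exact hcomp.congr heq (heq 0 self_mem_Ici)

/-- Raising ψ i only shrinks the cell of `x j`, so a null cell stays null. -/
theorem hasDerivWithinAt_measureReal_laguerreCell_of_null [IsFiniteMeasure μ] (hμ : μ ≪ volume)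
    (hx : Function.Injective x) (hij : i ≠ j) (h0 : volume (laguerreCell Ω x ψ j) = 0) :
    HasDerivWithinAt
      (fun t : ℝ => μ.real (laguerreCell Ω x (ψ + t • EuclideanSpace.single i 1) j)) 0
      (Ici 0) 0 := by
  have heq : ∀ t ∈ Ici (0 : ℝ),
      μ.real (laguerreCell Ω x (ψ + t • EuclideanSpace.single i 1) j) = 0 := by
    intro t ht
    rw [laguerreCell_add_single hx hij ht, measureReal_eq_zero_iff]
    exact measure_mono_null inter_subset_left (hμ h0)
  exact (hasDerivWithinAt_const _ _ _).congr heq (heq 0 self_mem_Ici)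

theorem volume_laguerreCell_eq_zero (hx : Function.Injective x) (hij : i ≠ j)
    (h : ¬ ∃ y ∈ laguerreCell Ω x ψ j,
      siteThreshold x ψ i j < inner ℝ (siteDirection x i j) y) :
    volume (laguerreCell Ω x ψ j) = 0 := by
  refine measure_mono_null (fun y hy => ?_)
    (volume_siteHyperplane hx hij (siteThreshold x ψ i j))
  exact le_antisymm (not_lt.1 fun hlt => h ⟨y, hy, hlt⟩) (siteThreshold_le_of_mem hx hij hy)

/-- The cells of positive volume cover a convex domain of positive volume. -/
theorem exists_mem_laguerreCell_volume_ne_zero [Nonempty (Fin n)] (hΩ : IsClosed Ω)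
    (hΩc : Convex ℝ Ω) (hvol : volume Ω ≠ 0) {y : EuclideanSpace ℝ (Fin d)} (hy : y ∈ Ω) :
    ∃ k, volume (laguerreCell Ω x ψ k) ≠ 0 ∧ y ∈ laguerreCell Ω x ψ k := by
  have hint : (interior Ω).Nonempty := by
    by_contra hemp
    rw [not_nonempty_iff_eq_empty] at hemp
    refine hvol (measure_mono_null (fun z hz => ?_) (hΩc.addHaar_frontier volume))
    exact ⟨subset_closure hz, by simp [hemp]⟩
  have hcl : closure (interior Ω) = Ω := by
    rw [hΩc.closure_interior_eq_closure_of_nonempty_interior hint, hΩ.closure_eq]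
  let N : Set (EuclideanSpace ℝ (Fin d)) :=
    ⋃ k ∈ {k | volume (laguerreCell Ω x ψ k) ≠ 0}, laguerreCell Ω x ψ k
  have hN : IsClosed N := (toFinite _).isClosed_biUnion fun k _ => isClosed_laguerreCell hΩ
  by_contra! hcon
  have hyN : y ∈ Nᶜ := by
    simp only [N, mem_compl_iff, mem_iUnion, not_exists]
    exact fun k hk => hcon k hk
  rw [← hcl] at hy
  -- This nonempty open set is covered by the null cells, although it has positive volume.
  have hopen : (Nᶜ ∩ interior Ω).Nonempty :=
    mem_closure_iff.1 hy _ hN.isOpen_compl hyN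
  refine ((hN.isOpen_compl.inter isOpen_interior).measure_pos volume hopen).ne' ?_
  refine measure_mono_null (t := ⋃ k ∈ {k | volume (laguerreCell Ω x ψ k) = 0},
    laguerreCell Ω x ψ k) (fun z hz => ?_) ?_
  · have hzΩ := interior_subset hz.2
    rw [← iUnion_laguerreCell (Ω := Ω) (x := x) (ψ := ψ)] at hzΩ
    obtain ⟨k, hk⟩ := mem_iUnion.1 hzΩ
    refine mem_biUnion (x := k) ?_ hk
    by_contra hk0
    exact hz.1 (mem_biUnion (x := k) hk0 hk)
  · exact (measure_biUnion_null_iff (to_countable _)).2 fun k hk => hk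

/-- At a point of twice differentiability, the mass of every cell is differentiable in every
weight, with the entries of a symmetric matrix as derivatives. -/
theorem exists_hessian_dualFunction [Nonempty (Fin n)] [IsFiniteMeasure μ] (hΩ : IsCompact Ω)
    (hμΩ : ∀ᵐ y ∂μ, y ∈ Ω) (hμ : μ ≪ volume) (hx : Function.Injective x) (w : Fin n → ℝ)
    (h2 : TwiceDifferentiableAt (dualFunction Ω μ x w) ψ) :
    ∃ H : Fin n → Fin n → ℝ, (∀ i j, H i j = H j i) ∧
      (∀ i j, partialDeriv i (partialDeriv j (dualFunction Ω μ x w)) ψ = H i j) ∧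
      ∀ i j, HasDerivAt
        (fun t : ℝ => μ.real (laguerreCell Ω x (ψ + t • EuclideanSpace.single i 1) j))
        (-H i j) 0 := by
  have hdiff : ∀ q, DifferentiableAt ℝ (dualFunction Ω μ x w) q := fun q =>
    (hasGradientAt_dualFunction hΩ hμΩ hμ hx w q).differentiableAt
  have hpart : ∀ j, partialDeriv j (dualFunction Ω μ x w) = fun q =>
      fderiv ℝ (dualFunction Ω μ x w) q (EuclideanSpace.single j 1) := fun j => by
    ext q
    exact (hdiff q).lineDeriv_eq_fderiv
  have hval : ∀ j q, fderiv ℝ (dualFunction Ω μ x w) q (EuclideanSpace.single j 1) =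
      w j - μ.real (laguerreCell Ω x q j) := fun j q => by
    rw [(hasGradientAt_iff_hasFDerivAt.1
      (hasGradientAt_dualFunction hΩ hμΩ hμ hx w q)).fderiv]
    simp [EuclideanSpace.inner_single_right]
  set D := fderiv ℝ (dualFunction Ω μ x w) with hD
  have hD' := h2.2.hasFDerivAt
  have hline : ∀ i j, HasLineDerivAt ℝ
      (fun q => D q (EuclideanSpace.single j 1))
      (fderiv ℝ D ψ (EuclideanSpace.single i 1) (EuclideanSpace.single j 1)) ψ
      (EuclideanSpace.single i 1) := fun i j => by
    have := (hD'.clm_apply (hasFDerivAt_const (EuclideanSpace.single j (1 : ℝ)) ψ)).hasLineDerivAt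
      (EuclideanSpace.single i 1)
    simpa using this
  refine ⟨fun i j => fderiv ℝ D ψ (EuclideanSpace.single i 1) (EuclideanSpace.single j 1),
    fun i j => ?_, fun i j => ?_, fun i j => ?_⟩
  -- Symmetry requires g to be differentiable near ψ but its derivative to be differentiable only at
  -- ψ, so no C² assumption enters.
  · exact second_derivative_symmetric (fun q => (hdiff q).hasFDerivAt) hD' _ _
  · rw [hpart j]
    exact (hline i j).lineDeriv
  · have h := hline i j
    simp only [HasLineDerivAt, hval] at h
    simpa using h.const_sub (w j)

/-- The formula for the mixed second derivatives of the dual function. -/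
theorem hessian_eq_setIntegral [Nonempty (Fin n)] [IsProbabilityMeasure μ] (hΩ : IsCompact Ω)
    (hΩc : Convex ℝ Ω) (hx : Function.Injective x) (hρ : ContinuousOn ρ Ω)
    (hρ0 : ∀ y ∈ Ω, 0 ≤ ρ y)
    (hμ : μ = (volume.restrict Ω).withDensity fun y => ENNReal.ofReal (ρ y))
    {H : Fin n → Fin n → ℝ} (hsymm : ∀ i j, H i j = H j i)
    (hH : ∀ i j, HasDerivAt
      (fun t : ℝ => μ.real (laguerreCell Ω x (ψ + t • EuclideanSpace.single i 1) j))
      (-H i j) 0) (hij : i ≠ j) :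
    H i j = ∫ y in laguerreCell Ω x ψ i ∩ laguerreCell Ω x ψ j, ρ y / (2 * ‖x i - x j‖)
        ∂(Measure.euclideanHausdorffMeasure (d - 1)) := by
  have hac : μ ≪ volume := by
    rw [hμ]
    exact (withDensity_absolutelyContinuous _ _).trans Measure.restrict_le_self.absolutelyContinuous
  have hvol : volume Ω ≠ 0 := by
    intro h0
    have h1 : μ univ = 0 := by
      rw [hμ, Measure.restrict_eq_zero.2 h0]
      simp
    simp at h1
  have hzero : ∀ {i j : Fin n}, i ≠ j → volume (laguerreCell Ω x ψ j) = 0 → H i j = 0 := by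
    intro i j hij h0
    have := (uniqueDiffWithinAt_Ici (0 : ℝ)).eq_deriv _ (hH i j).hasDerivWithinAt
      (hasDerivWithinAt_measureReal_laguerreCell_of_null hac hx hij h0)
    simpa using this
  have hnondeg : ∀ {i j : Fin n}, i ≠ j → (∃ y ∈ laguerreCell Ω x ψ j,
      siteThreshold x ψ i j < inner ℝ (siteDirection x i j) y) → H i j =
      ∫ y in laguerreCell Ω x ψ i ∩ laguerreCell Ω x ψ j, ρ y / (2 * ‖x i - x j‖)
        ∂(Measure.euclideanHausdorffMeasure (d - 1)) := by
    intro i j hij hne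
    exact neg_injective ((uniqueDiffWithinAt_Ici (0 : ℝ)).eq_deriv _ (hH i j).hasDerivWithinAt
      (hasDerivWithinAt_measureReal_laguerreCell hΩ hΩc hx hρ hρ0 hμ hij hne))
  by_cases h1 : ∃ y ∈ laguerreCell Ω x ψ j,
      siteThreshold x ψ i j < inner ℝ (siteDirection x i j) y
  · exact hnondeg hij h1
  by_cases h2 : ∃ y ∈ laguerreCell Ω x ψ i,
      siteThreshold x ψ j i < inner ℝ (siteDirection x j i) y
  -- Only the cell of `x i` is nondegenerate here: exchange the roles of i and j.
  · rw [hsymm i j, hnondeg hij.symm h2, inter_comm, norm_sub_rev]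
  have hi0 := volume_laguerreCell_eq_zero hx hij.symm h2
  rw [hzero hij (volume_laguerreCell_eq_zero hx hij h1)]
  -- For such k the entry is the face integral by nondegeneracy of the cell of `x k`, and is 0 by
  -- symmetry since the cell of `x i` is null. As ρ ≥ 0, it vanishes almost everywhere on the face.
  have hface : ∀ k, volume (laguerreCell Ω x ψ k) ≠ 0 →
      ∀ᵐ y ∂((Measure.euclideanHausdorffMeasure (d - 1)).restrict
        (laguerreCell Ω x ψ i ∩ laguerreCell Ω x ψ k)), ρ y = 0 := by
    intro k hk
    have hik : i ≠ k := fun h => hk (h ▸ hi0)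
    have hnd : ∃ y ∈ laguerreCell Ω x ψ k,
        siteThreshold x ψ i k < inner ℝ (siteDirection x i k) y := by
      by_contra hcon
      exact hk (volume_laguerreCell_eq_zero hx hik hcon)
    have hint := hnondeg hik hnd
    have hpos : 2 * ‖x i - x k‖ ≠ 0 :=
      mul_ne_zero two_ne_zero (norm_ne_zero_iff.2 (sub_ne_zero.2 (hx.ne hik)))
    rw [hsymm, hzero hik.symm hi0, integral_div, eq_comm, div_eq_zero_iff,
      or_iff_left hpos] at hint
    have hcomp : IsCompact (laguerreCell Ω x ψ i ∩ laguerreCell Ω x ψ k) :=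
      (isCompact_laguerreCell hΩ).inter (isCompact_laguerreCell hΩ)
    have hsub : laguerreCell Ω x ψ i ∩ laguerreCell Ω x ψ k ⊆ Ω :=
      inter_subset_left.trans laguerreCell_subset
    have hfin : Measure.euclideanHausdorffMeasure (d - 1)
        (laguerreCell Ω x ψ i ∩ laguerreCell Ω x ψ k) < ∞ := by
      have := euclideanHausdorffMeasure_slice_lt_top (norm_siteDirection (hx.ne hik))
        (isCompact_laguerreCell hΩ (x := x) (ψ := ψ) (i := k)) (siteThreshold x ψ i k)
      rwa [finrank_euclideanSpace_fin, ← laguerreCell_inter_laguerreCell hx hik] at this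
    obtain ⟨M, hM⟩ := hΩ.exists_bound_of_continuousOn hρ
    have hintegrable : IntegrableOn ρ (laguerreCell Ω x ψ i ∩ laguerreCell Ω x ψ k)
        (Measure.euclideanHausdorffMeasure (d - 1)) :=
      IntegrableOn.of_bound hfin
        ((hρ.mono hsub).aestronglyMeasurable hcomp.measurableSet) M
        ((ae_restrict_mem hcomp.measurableSet).mono fun y hy => hM y (hsub hy))
    exact (setIntegral_eq_zero_iff_of_nonneg_ae
      ((ae_restrict_mem hcomp.measurableSet).mono fun y hy => hρ0 y (hsub hy)) hintegrable).1 hint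
  have hcover : laguerreCell Ω x ψ i ∩ laguerreCell Ω x ψ j ⊆
      ⋃ k ∈ {k | volume (laguerreCell Ω x ψ k) ≠ 0},
        laguerreCell Ω x ψ i ∩ laguerreCell Ω x ψ k := by
    intro y hy
    obtain ⟨k, hk, hyk⟩ :=
      exists_mem_laguerreCell_volume_ne_zero (x := x) (ψ := ψ) hΩ.isClosed hΩc hvol hy.1.1
    exact mem_biUnion (x := k) hk ⟨hy.1, hyk⟩
  have hae : ∀ᵐ y ∂((Measure.euclideanHausdorffMeasure (d - 1)).restrict
      (laguerreCell Ω x ψ i ∩ laguerreCell Ω x ψ j)), ρ y = 0 :=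
    ae_restrict_of_ae_restrict_of_subset hcover
      ((ae_restrict_biUnion_iff _ (to_countable _) _).2 hface)
  exact (integral_eq_zero_of_ae (hae.mono fun y hy => by simp [hy])).symm

/-- The masses of the cells add up to 1 for every ψ; differentiate this constant. -/
theorem sum_hessian_eq_zero [Nonempty (Fin n)] [IsProbabilityMeasure μ] (hΩ : IsClosed Ω)
    (hμΩ : ∀ᵐ y ∂μ, y ∈ Ω) (hμ : μ ≪ volume) (hx : Function.Injective x)
    {H : Fin n → Fin n → ℝ}
    (hH : ∀ i j, HasDerivAt
      (fun t : ℝ => μ.real (laguerreCell Ω x (ψ + t • EuclideanSpace.single i 1) j))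
      (-H i j) 0) (i : Fin n) : ∑ j, H i j = 0 := by
  have h := HasDerivAt.fun_sum (u := Finset.univ) fun j _ => hH i j
  simp only [sum_measureReal_laguerreCell hΩ hμΩ hμ hx] at h
  have := h.unique (hasDerivAt_const _ _)
  rwa [Finset.sum_neg_distrib, neg_eq_zero] at this

end SecondDerivative

end SemiDiscrete

/-! ### The main theorem -/

theorem mainTheorem1 (d n : ℕ) (hd : 1 ≤ d)
    (Ω : Set (EuclideanSpace ℝ (Fin d))) (hΩ : SemiDiscrete.IsCompactConvexPolyhedron Ω)
    (ρ : EuclideanSpace ℝ (Fin d) → ℝ) (hρm : AEMeasurable ρ (volume.restrict Ω))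
    (hρ0 : ∀ y ∈ Ω, 0 ≤ ρ y)
    (μ : Measure (EuclideanSpace ℝ (Fin d)))
    (hμ : μ = (volume.restrict Ω).withDensity (fun y => ENNReal.ofReal (ρ y)))
    (hμ1 : IsProbabilityMeasure μ)
    (x : Fin n → EuclideanSpace ℝ (Fin d)) (hxΩ : ∀ i, x i ∈ Ω) (hx : Function.Injective x)
    (w : Fin n → ℝ) (hw : w ∈ stdSimplex ℝ (Fin n)) :
    -- concavity
    ConcaveOn ℝ Set.univ (SemiDiscrete.dualFunction Ω μ x w) ∧
    -- differentiability, with the formula for the gradient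
    (∀ ψ : EuclideanSpace ℝ (Fin n),
      HasGradientAt (SemiDiscrete.dualFunction Ω μ x w)
        (WithLp.toLp 2 (fun i => w i - μ.real (SemiDiscrete.laguerreCell Ω x ψ i))) ψ) ∧
    -- Lipschitz continuity of the gradient, for a bounded density
    ((∃ M : ℝ, ∀ᵐ y ∂(volume.restrict Ω), ρ y ≤ M) →
      ∃ K : ℝ≥0, LipschitzWith K (gradient (SemiDiscrete.dualFunction Ω μ x w))) ∧
    -- second derivatives, for a continuously differentiable density
    (ContDiffOn ℝ 1 ρ Ω →
      (∀ᵐ ψ : EuclideanSpace ℝ (Fin n),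
        SemiDiscrete.TwiceDifferentiableAt (SemiDiscrete.dualFunction Ω μ x w) ψ) ∧
      ∀ ψ : EuclideanSpace ℝ (Fin n),
        SemiDiscrete.TwiceDifferentiableAt (SemiDiscrete.dualFunction Ω μ x w) ψ →
        (∀ i j : Fin n, i ≠ j →
          SemiDiscrete.partialDeriv i
            (SemiDiscrete.partialDeriv j (SemiDiscrete.dualFunction Ω μ x w)) ψ =
          ∫ y in frontier (SemiDiscrete.laguerreCell Ω x ψ i) ∩
              frontier (SemiDiscrete.laguerreCell Ω x ψ j),
            ρ y / (2 * ‖x i - x j‖) ∂(Measure.euclideanHausdorffMeasure (d - 1))) ∧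
        ∀ i : Fin n,
          ∑ j, SemiDiscrete.partialDeriv i
            (SemiDiscrete.partialDeriv j (SemiDiscrete.dualFunction Ω μ x w)) ψ = 0) := by
  -- An empty sum of weights would be 0, not 1.
  have hne : Nonempty (Fin n) := by
    by_contra hemp
    rw [not_nonempty_iff] at hemp
    simpa using hw.2
  have hcomp := hΩ.1
  have hμΩ : ∀ᵐ y ∂μ, y ∈ Ω := by
    rw [hμ]
    exact (withDensity_absolutelyContinuous _ _).ae_le (ae_restrict_mem hcomp.measurableSet)
  have hac : μ ≪ volume := by
    rw [hμ]
    exact (withDensity_absolutelyContinuous _ _).trans Measure.restrict_le_self.absolutelyContinuous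
  have hlip : (∃ M : ℝ, ∀ᵐ y ∂(volume.restrict Ω), ρ y ≤ M) →
      ∃ K : ℝ≥0, LipschitzWith K (gradient (SemiDiscrete.dualFunction Ω μ x w)) := by
    rintro ⟨M, hM⟩
    refine SemiDiscrete.exists_lipschitzWith_gradient_dualFunction hcomp hμΩ hx w
      (c := ENNReal.ofReal M) ENNReal.ofReal_ne_top ?_
    calc μ ≤ (volume.restrict Ω).withDensity fun _ => ENNReal.ofReal M := by
          rw [hμ]
          exact withDensity_mono (hM.mono fun y hy => ENNReal.ofReal_le_ofReal hy)
      _ = ENNReal.ofReal M • volume.restrict Ω := withDensity_const _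
      _ ≤ ENNReal.ofReal M • volume := by
          gcongr
          exact Measure.restrict_le_self
  refine ⟨SemiDiscrete.concaveOn_dualFunction hcomp hμΩ hac hx w,
    SemiDiscrete.hasGradientAt_dualFunction hcomp hμΩ hac hx w, hlip, fun hρ1 => ⟨?_, ?_⟩⟩
  -- Continuity on the compact `Ω` bounds ρ, so the derivative of g is Lipschitz and Rademacher's
  -- theorem applies to it.
  · obtain ⟨M, hM⟩ := hcomp.exists_bound_of_continuousOn hρ1.continuousOn
    obtain ⟨K, hK⟩ := hlip ⟨M, (ae_restrict_mem hcomp.measurableSet).mono fun y hy =>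
      (le_abs_self _).trans (hM y hy)⟩
    have hfd : LipschitzWith (1 * K) (fderiv ℝ (SemiDiscrete.dualFunction Ω μ x w)) := by
      rw [← toDual_comp_gradient]
      exact (InnerProductSpace.toDual ℝ (EuclideanSpace ℝ (Fin n))).lipschitz.comp hK
    filter_upwards [hfd.ae_differentiableAt] with ψ hψ
    exact ⟨Filter.Eventually.of_forall fun q =>
      (SemiDiscrete.hasGradientAt_dualFunction hcomp hμΩ hac hx w q).differentiableAt, hψ⟩
  · intro ψ hψ
    obtain ⟨H, hsymm, hpart, hH⟩ :=
      SemiDiscrete.exists_hessian_dualFunction hcomp hμΩ hac hx w hψ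
    simp only [hpart]
    refine ⟨fun i j hij => ?_,
      SemiDiscrete.sum_hessian_eq_zero hcomp.isClosed hμΩ hac hx hH⟩
    rw [SemiDiscrete.frontier_inter_frontier_laguerreCell hcomp.isClosed hx hij]
    exact SemiDiscrete.hessian_eq_setIntegral hcomp hΩ.convex hx hρ1.continuousOn hρ0 hμ hsymm hH
      hij
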